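/- Let $G\in\mathbb{R}^{N\times N}$, let $\lambda=a+ib$ with $a,b\in\mathbb{R}$, $b\neq 0$, be a non-real eigenvalue of $G$, and let $w=u+iv\in\mathbb{C}^N$ ($u,v\in\mathbb{R}^N$) be a corresponding left eigenvector, i.e. $w\neq 0$ and $w^*G=\lambda w^*$. Fix $t_0>0$ and consider the system $$\ddot q(t)+\tfrac{3}{t}\,\dot q(t)+G\,q(t)=0,\qquad t\ge t_0,\qquad q(t)\in\mathbb{R}^N .$$ Let $\sqrt{\lambda}$ denote the principal square root and put $\beta=|\mathrm{Im}\sqrt{\lambda}|$. Then $$\beta=\sqrt{\frac{\sqrt{a^2+b^2}-a}{2}}>0,$$ and there is a proper linear subspace $E\subsetneq\mathbb{R}^N\times\mathbb{R}^N$ such that, for every initial condition $(q(t_0),\dot q(t_0))=(q_0,v_0)\notin E$, the function $$\rho(t)=\sqrt{(u^\top q(t))^2+(v^\top q(t))^2}$$ tends to $\infty$ exponentially at rate $\beta$ as $t\to\infty$: that is, $\rho(t)\to\infty$, $\tfrac1t\log\rho(t)\to\beta$, and more precisely $\rho(t)\sim C\,t^{-3/2}e^{\beta t}$ for some constant $C>0$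 (depending on the trajectory). In particular this holds for Lebesgue-almost every initial condition and on an open dense set of initial conditions. -/

import Mathlib

open Filter Topology Matrix

/-- `w` is a left eigenvector of the real matrix `G` for the complex eigenvalue `lam`:
`w ≠ 0` and `w^* G = lam w^*`, where `w^*` is the conjugate transpose of `w`. -/
def IsLeftEigenvector {N : ℕ} (G : Matrix (Fin N) (Fin N) ℝ) (lam : ℂ) (w : Fin N → ℂ) : Prop :=
  w ≠ 0 ∧ star w ᵥ* G.map (fun x : ℝ => (x : ℂ)) = lam • star w

/-- `q`, with velocity `p`, is a trajectory on `[t₀, ∞)` of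
`q'' + (3 / t) q' + G q = 0` (one-sided derivatives at `t₀`). -/
structure IsNAGDTrajectory {N : ℕ} (G : Matrix (Fin N) (Fin N) ℝ) (t₀ : ℝ)
    (q p : ℝ → Fin N → ℝ) : Prop where
  hasDeriv_pos : ∀ t, t₀ ≤ t → HasDerivWithinAt q (p t) (Set.Ici t₀) t
  hasDeriv_vel : ∀ t, t₀ ≤ t →
    HasDerivWithinAt p (-((3 / t) • p t) - G *ᵥ q t) (Set.Ici t₀) t

/-- A property of the initial position and velocity holds for generic initial conditions if it
holds off a proper linear subspace of `ℝ^N × ℝ^N` (so off a closed, nowhere dense null set). -/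
def ForGenericInitialConditions {N : ℕ} (P : (Fin N → ℝ) → (Fin N → ℝ) → Prop) : Prop :=
  ∃ E : Submodule ℝ ((Fin N → ℝ) × (Fin N → ℝ)), E ≠ ⊤ ∧
    ∀ q₀ v₀ : Fin N → ℝ, (q₀, v₀) ∉ E → P q₀ v₀

/-- `f(t) → ∞` exponentially at rate `r`, that is `log (f t) / t → r`, with the algebraic
correction `t ^ (-3/2)`: `f(t) ∼ C t ^ (-3/2) exp (r t)` for some constant `C > 0`. -/
structure GrowsExponentiallyAtRate (f : ℝ → ℝ) (r : ℝ) : Prop where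
  tendsto_atTop : Tendsto f atTop atTop
  tendsto_log_div : Tendsto (fun t => Real.log (f t) / t) atTop (𝓝 r)
  sharp : ∃ C : ℝ, 0 < C ∧
    Tendsto (fun t => f t / (t ^ (-(3 / 2) : ℝ) * Real.exp (r * t))) atTop (𝓝 C)

/-- `ρ = √((uᵀ x)² + (vᵀ x)²)`, for the real and imaginary parts `u`, `v` of a complex vector. -/
noncomputable def modalRadius {N : ℕ} (u v x : Fin N → ℝ) : ℝ :=
  Real.sqrt ((u ⬝ᵥ x) ^ 2 + (v ⬝ᵥ x) ^ 2)

/-! Pairing with $w^*$ decouples the system: $z=w^*q$ solves $z''+(3/t)z'+\lambda z=0$ and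
$|z|=\rho$. For $y=t^{3/2}z$ and $\mu^2=-\lambda$ with $\mathrm{Re}\,\mu=\beta>0$, this becomes
$y''=(\mu^2+3/(4t^2))y$. The modes $p,m=(y'\pm\mu y)e^{-\mu t}$ are coupled only at size
$O(t^{-2})$, which is integrable, so $m\to0$ and $p\to L$ (`tendsto_decaying`,
`exists_tendsto_growing`). As $p-m=2\mu ye^{-\mu t}$, the asymptotics of $\rho$ follow whenever
$L\ne0$.

The condition $L=0$ is linear in the initial data and defines $E$. It is proper: if two solutions
with nonzero Wronskian both had $L=0$, some combination would have $m(T)=0\ne p(T)$ at a late time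
$T$, and from then on dominance of $p$ prevents $p\to0$ (`exists_forall_not_tendsto_zero`). -/

/-- The diagonalised first-order form of `y'' = (μ ^ 2 + 2 μ κ / t ^ 2) y`, with the growing
factor `exp (μ t)` removed from both modes. -/
structure IsModePair (μ κ : ℂ) (t₀ : ℝ) (p m : ℝ → ℂ) : Prop where
  hasDerivAt_growing : ∀ t, t₀ < t → HasDerivAt p (κ / (t : ℂ) ^ 2 * (p t - m t)) t
  hasDerivAt_decaying : ∀ t, t₀ < t →
    HasDerivAt m (-(2 * μ) * m t + κ / (t : ℂ) ^ 2 * (p t - m t)) t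

/-! ### Calculus on half-lines. -/

theorem monotoneOn_Ioi_of_hasDerivAt_nonneg {f f' : ℝ → ℝ} {T : ℝ}
    (hf : ∀ t, T < t → HasDerivAt f (f' t) t) (hf' : ∀ t, T < t → 0 ≤ f' t) :
    MonotoneOn f (Set.Ioi T) := by
  refine monotoneOn_of_deriv_nonneg (convex_Ioi T)
    (fun t ht => (hf t ht).continuousAt.continuousWithinAt) ?_ ?_
  · rw [interior_Ioi]
    exact fun t ht => (hf t ht).differentiableAt.differentiableWithinAt
  · rw [interior_Ioi]
    intro t ht
    rw [(hf t ht).deriv]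
    exact hf' t ht

theorem antitoneOn_Ioi_of_hasDerivAt_nonpos {f f' : ℝ → ℝ} {T : ℝ}
    (hf : ∀ t, T < t → HasDerivAt f (f' t) t) (hf' : ∀ t, T < t → f' t ≤ 0) :
    AntitoneOn f (Set.Ioi T) := by
  have h := monotoneOn_Ioi_of_hasDerivAt_nonneg (f := fun t => -f t)
    (fun t ht => (hf t ht).neg) (fun t ht => neg_nonneg.2 (hf' t ht))
  exact fun x hx y hy hxy => neg_le_neg_iff.1 (h hx hy hxy)

theorem hasDerivAt_exp_const_div (a : ℝ) {t : ℝ} (ht : t ≠ 0) :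
    HasDerivAt (fun s : ℝ => Real.exp (a / s)) (Real.exp (a / t) * (-a / t ^ 2)) t := by
  have h : HasDerivAt (fun s : ℝ => a / s) (-a / t ^ 2) t := by
    simpa [div_eq_mul_inv] using (hasDerivAt_inv ht).const_mul a
  exact h.exp

theorem inner_mul_self_complex (c z : ℂ) : inner ℝ z (c * z) = c.re * ‖z‖ ^ 2 := by
  rw [Complex.inner, ← Complex.normSq_eq_norm_sq, Complex.normSq_apply]
  simp
  ring

/-! ### Asymptotics of the mode system by energy estimates. -/

namespace IsModePair

variable {μ κ : ℂ} {t₀ : ℝ} {p m : ℝ → ℂ}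

theorem add {p' m' : ℝ → ℂ} (h : IsModePair μ κ t₀ p m) (h' : IsModePair μ κ t₀ p' m') :
    IsModePair μ κ t₀ (fun t => p t + p' t) (fun t => m t + m' t) where
  hasDerivAt_growing t ht := by
    exact ((h.hasDerivAt_growing t ht).add (h'.hasDerivAt_growing t ht)).congr_deriv (by ring)
  hasDerivAt_decaying t ht := by
    exact ((h.hasDerivAt_decaying t ht).add (h'.hasDerivAt_decaying t ht)).congr_deriv (by ring)

theorem const_mul (h : IsModePair μ κ t₀ p m) (c : ℂ) :
    IsModePair μ κ t₀ (fun t => c * p t) (fun t => c * m t) where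
  hasDerivAt_growing t ht := by
    exact ((h.hasDerivAt_growing t ht).const_mul c).congr_deriv (by ring)
  hasDerivAt_decaying t ht := by
    exact ((h.hasDerivAt_decaying t ht).const_mul c).congr_deriv (by ring)

theorem abs_inner_coupling_le (z p m : ℂ) {κ : ℂ} {t : ℝ} :
    |inner ℝ z (κ / (t : ℂ) ^ 2 * (p - m))| ≤ ‖κ‖ / t ^ 2 * (‖z‖ * (‖p‖ + ‖m‖)) := by
  refine (abs_real_inner_le_norm _ _).trans ?_
  rw [norm_mul, norm_div, norm_pow, Complex.norm_real, Real.norm_eq_abs, sq_abs]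
  have : ‖p - m‖ ≤ ‖p‖ + ‖m‖ := norm_sub_le _ _
  calc ‖z‖ * (‖κ‖ / t ^ 2 * ‖p - m‖) = ‖κ‖ / t ^ 2 * (‖z‖ * ‖p - m‖) := by ring
    _ ≤ _ := by gcongr

theorem hasDerivAt_norm_sq_growing (h : IsModePair μ κ t₀ p m) {t : ℝ} (ht : t₀ < t) :
    HasDerivAt (fun s => ‖p s‖ ^ 2) (2 * inner ℝ (p t) (κ / (t : ℂ) ^ 2 * (p t - m t))) t :=
  (h.hasDerivAt_growing t ht).norm_sq

theorem hasDerivAt_norm_sq_decaying (h : IsModePair μ κ t₀ p m) {t : ℝ} (ht : t₀ < t) :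
    HasDerivAt (fun s => ‖m s‖ ^ 2)
      (-(4 * μ.re) * ‖m t‖ ^ 2 + 2 * inner ℝ (m t) (κ / (t : ℂ) ^ 2 * (p t - m t))) t := by
  convert (h.hasDerivAt_decaying t ht).norm_sq using 1
  rw [inner_add_right, inner_mul_self_complex]
  simp
  ring

/-- The coupling raises the energy at relative rate at most $4c/t^2$, $c=|\kappa|$; the weight
$e^{4c/t}$ cancels exactly this. -/
theorem exists_bound (h : IsModePair μ κ t₀ p m) (hμ : 0 < μ.re) (ht₀ : 0 < t₀) :
    ∃ K : ℝ, 0 < K ∧ ∀ t, t₀ + 1 ≤ t → ‖p t‖ ^ 2 + ‖m t‖ ^ 2 ≤ K := by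
  set c := ‖κ‖ with hc
  have hc0 : 0 ≤ c := norm_nonneg _
  have hanti := antitoneOn_Ioi_of_hasDerivAt_nonpos (T := t₀)
    (f := fun t => (‖p t‖ ^ 2 + ‖m t‖ ^ 2) * Real.exp (4 * c / t))
    (fun t ht => ((h.hasDerivAt_norm_sq_growing ht).add (h.hasDerivAt_norm_sq_decaying ht)).mul
      (hasDerivAt_exp_const_div (4 * c) (ht₀.trans ht).ne'))
    (by
      intro t ht
      have ht0 : 0 < t := ht₀.trans ht
      have h1 := (abs_le.1 (abs_inner_coupling_le (κ := κ) (t := t) (p t) (p t) (m t))).2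
      have h2 := (abs_le.1 (abs_inner_coupling_le (κ := κ) (t := t) (m t) (p t) (m t))).2
      have hd : 0 ≤ c / t ^ 2 := by positivity
      have hm : 0 ≤ μ.re * ‖m t‖ ^ 2 := by positivity
      have h3 : c / t ^ 2 * (‖p t‖ * (‖p t‖ + ‖m t‖)) + c / t ^ 2 * (‖m t‖ * (‖p t‖ + ‖m t‖))
          ≤ c / t ^ 2 * (2 * (‖p t‖ ^ 2 + ‖m t‖ ^ 2)) := by
        rw [← mul_add]
        gcongr
        nlinarith [sq_nonneg (‖p t‖ - ‖m t‖)]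
      have h4 : -(4 * c) / t ^ 2 = -4 * (c / t ^ 2) := by ring
      simp only [Pi.add_apply]
      rw [h4]
      have := (Real.exp_pos (4 * c / t)).le
      refine le_trans (le_of_eq ?_) (mul_nonpos_of_nonpos_of_nonneg (a :=
        2 * inner ℝ (p t) (κ / (t : ℂ) ^ 2 * (p t - m t)) + (-(4 * μ.re) * ‖m t‖ ^ 2
          + 2 * inner ℝ (m t) (κ / (t : ℂ) ^ 2 * (p t - m t)))
          - 4 * (c / t ^ 2) * (‖p t‖ ^ 2 + ‖m t‖ ^ 2)) ?_ this)
      · ring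
      · linarith)
  -- The mode equations are only given for $t>t_0$, hence the base time $t_0+1$; the final `+ 1`
  -- makes the bound positive.
  refine ⟨(‖p (t₀ + 1)‖ ^ 2 + ‖m (t₀ + 1)‖ ^ 2) * Real.exp (4 * c / (t₀ + 1)) + 1,
    by positivity, fun t ht => ?_⟩
  have h1 := hanti (a := t₀ + 1) (b := t) (by simp) (by simp; linarith) ht
  have h2 : 1 ≤ Real.exp (4 * c / t) := Real.one_le_exp (by
    have : 0 < t := by linarith
    positivity)
  have h3 := le_mul_of_one_le_right (a := ‖p t‖ ^ 2 + ‖m t‖ ^ 2) (by positivity) h2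
  simp only at h1
  linarith

theorem tendsto_decaying (h : IsModePair μ κ t₀ p m) (hμ : 0 < μ.re) (ht₀ : 0 < t₀) :
    Tendsto m atTop (𝓝 0) := by
  obtain ⟨K, hK, hb⟩ := h.exists_bound hμ ht₀
  set c := ‖κ‖ with hc
  have hc0 : 0 ≤ c := norm_nonneg _
  set β := μ.re with hβ
  set k := 4 * c * K with hk
  have hk0 : 0 ≤ k := by positivity
  -- Coupling and the derivative of $-k/t$ contribute at most $k/t^2$ each; beyond $1/(2\beta)$
  -- their sum is below the damping $4\beta k/t$.
  set T := max (t₀ + 1) (1 / (2 * β)) with hT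
  have hexp : ∀ t : ℝ, HasDerivAt (fun s : ℝ => Real.exp (4 * β * s))
      (Real.exp (4 * β * t) * (4 * β)) t := fun t => by
    simpa using ((hasDerivAt_id t).const_mul (4 * β)).exp
  have hinv : ∀ t : ℝ, t ≠ 0 → HasDerivAt (fun s : ℝ => k / s) (-k / t ^ 2) t := fun t ht => by
    simpa [div_eq_mul_inv] using (hasDerivAt_inv ht).const_mul k
  have hT1 : ∀ t, T < t → t₀ + 1 < t ∧ 1 / (2 * β) < t := fun t ht =>
    ⟨(le_max_left _ _).trans_lt ht, (le_max_right _ _).trans_lt ht⟩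
  have hanti := antitoneOn_Ioi_of_hasDerivAt_nonpos (T := T)
    (f := fun t => (‖m t‖ ^ 2 - k / t) * Real.exp (4 * β * t))
    (fun t ht => ((h.hasDerivAt_norm_sq_decaying (by linarith [(hT1 t ht).1])).sub
      (hinv t (by linarith [(hT1 t ht).1]))).mul (hexp t))
    (by
      intro t ht
      obtain ⟨hta, htb⟩ := hT1 t ht
      have ht0 : 0 < t := by linarith
      have h2 := (abs_le.1 (abs_inner_coupling_le (κ := κ) (t := t) (m t) (p t) (m t))).2
      have hd : 0 ≤ c / t ^ 2 := by positivity
      have h3 : c / t ^ 2 * (‖m t‖ * (‖p t‖ + ‖m t‖)) ≤ c / t ^ 2 * (2 * K) := by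
        refine mul_le_mul_of_nonneg_left ?_ hd
        nlinarith [sq_nonneg (‖p t‖ - ‖m t‖), hb t hta.le, sq_nonneg (‖p t‖)]
      have h4 : 2 * (k / t ^ 2) ≤ 4 * β * (k / t) := by
        rw [div_lt_iff₀ (by positivity)] at htb
        have : 4 * β * (k / t) = 4 * β * t * (k / t ^ 2) := by field_simp
        rw [this]
        have : 0 ≤ k / t ^ 2 := by positivity
        nlinarith
      have h5 : c / t ^ 2 * (2 * K) = k / t ^ 2 / 2 := by rw [hk]; ring
      have h6 : -k / t ^ 2 = -(k / t ^ 2) := by ring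
      simp only [Pi.sub_apply]
      rw [h6]
      refine le_trans (le_of_eq ?_) (mul_nonpos_of_nonpos_of_nonneg (a :=
        2 * inner ℝ (m t) (κ / (t : ℂ) ^ 2 * (p t - m t)) + k / t ^ 2 - 4 * β * (k / t))
        ?_ (Real.exp_pos (4 * β * t)).le)
      · ring
      · linarith)
  have hTpos : 0 < T := lt_of_lt_of_le (by linarith) (le_max_left (t₀ + 1) _)
  set A := (‖m (T + 1)‖ ^ 2 - k / (T + 1)) * Real.exp (4 * β * (T + 1)) with hA
  have hlim : Tendsto (fun t : ℝ => k / t + A * Real.exp (-(4 * β * t))) atTop (𝓝 0) := by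
    have h1 : Tendsto (fun t : ℝ => k / t) atTop (𝓝 0) := tendsto_const_nhds.div_atTop tendsto_id
    have h2 : Tendsto (fun t : ℝ => Real.exp (-(4 * β * t))) atTop (𝓝 0) :=
      Real.tendsto_exp_neg_atTop_nhds_zero.comp
        (tendsto_id.const_mul_atTop (by positivity : 0 < 4 * β))
    simpa using h1.add (h2.const_mul A)
  have hsq : Tendsto (fun t => ‖m t‖ ^ 2) atTop (𝓝 0) := by
    refine squeeze_zero' (Eventually.of_forall fun t => by positivity) ?_ hlim
    filter_upwards [eventually_ge_atTop (T + 1)] with t ht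
    have h1 := hanti (a := T + 1) (b := t) (by simp) (by simp; linarith) ht
    simp only at h1
    rw [← hA] at h1
    have h2 := mul_le_mul_of_nonneg_right h1 (Real.exp_pos (-(4 * β * t))).le
    rw [mul_assoc, ← Real.exp_add, add_neg_cancel, Real.exp_zero, mul_one] at h2
    linarith
  have := hsq.sqrt
  simp only [Real.sqrt_zero, norm_nonneg, Real.sqrt_sq] at this
  exact tendsto_zero_iff_norm_tendsto_zero.2 this

/-- Bounded modes make $p'=O(t^{-2})$, which is integrable at infinity. -/
theorem exists_tendsto_growing (h : IsModePair μ κ t₀ p m) (hμ : 0 < μ.re) (ht₀ : 0 < t₀) :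
    ∃ L : ℂ, Tendsto p atTop (𝓝 L) := by
  obtain ⟨K, hK, hb⟩ := h.exists_bound hμ ht₀
  refine ⟨_, MeasureTheory.tendsto_limUnder_of_hasDerivAt_of_integrableOn_Ioi (a := t₀ + 1)
    (fun t ht => h.hasDerivAt_growing t (by linarith [Set.mem_Ioi.1 ht])) ?_⟩
  have hint := (integrableOn_Ioi_rpow_of_lt (a := -2) (c := t₀ + 1) (by norm_num)
    (by linarith)).const_mul (‖κ‖ * (K + 1))
  refine hint.mono' (ContinuousOn.aestronglyMeasurable (fun t ht => ?_) measurableSet_Ioi) ?_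
  · have ht' : t₀ < t := by linarith [Set.mem_Ioi.1 ht]
    have ht0 : (t : ℂ) ≠ 0 := by exact_mod_cast (ht₀.trans ht').ne'
    have h1 := (h.hasDerivAt_growing t ht').continuousAt
    have h2 := (h.hasDerivAt_decaying t ht').continuousAt
    have h3 : ContinuousAt (fun s : ℝ => κ / (s : ℂ) ^ 2) t :=
      continuousAt_const.div (by fun_prop) (pow_ne_zero 2 ht0)
    exact (h3.mul (h1.sub h2)).continuousWithinAt
  · refine MeasureTheory.ae_restrict_of_forall_mem measurableSet_Ioi fun t ht => ?_
    have ht' : t₀ + 1 < t := ht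
    have ht0 : 0 < t := by linarith
    rw [norm_mul, norm_div, norm_pow, Complex.norm_real, Real.norm_eq_abs, sq_abs,
      Real.rpow_neg ht0.le, Real.rpow_two]
    have h1 : ‖p t - m t‖ ≤ K + 1 := by
      have := norm_sub_le (p t) (m t)
      nlinarith [hb t ht'.le, sq_nonneg (‖p t‖ - 1), sq_nonneg (‖m t‖ - 1)]
    calc ‖κ‖ / t ^ 2 * ‖p t - m t‖ ≤ ‖κ‖ / t ^ 2 * (K + 1) := by gcongr
      _ = ‖κ‖ * (K + 1) * (t ^ 2)⁻¹ := by ring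

/-- Past a threshold the growing mode, if it dominates at some time, does not tend to zero. -/
theorem exists_forall_not_tendsto_zero (hμ : 0 < μ.re) (ht₀ : 0 < t₀) :
    ∃ T, t₀ < T ∧ ∀ p m : ℝ → ℂ, IsModePair μ κ t₀ p m → m T = 0 → p T ≠ 0 →
      ¬ Tendsto p atTop (𝓝 0) := by
  set c := ‖κ‖ with hc
  have hc0 : 0 ≤ c := norm_nonneg _
  set β := μ.re with hβ
  -- Since $t\ge1$, going beyond $2c/\beta$ gives $2c/t^2\le\beta$, so the damping $4\beta|m|^2$
  -- absorbs the $8c|m|^2/t^2$ left by the coupling and the weight. The threshold does not depend on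
  -- the pair.
  set S := max (t₀ + 1) (2 * c / β) with hS
  have hS1 : t₀ + 1 ≤ S := le_max_left _ _
  refine ⟨S + 1, by linarith, fun p m h hm hp hlim => ?_⟩
  have hmono := monotoneOn_Ioi_of_hasDerivAt_nonneg (T := S)
    (f := fun t => (‖p t‖ ^ 2 - ‖m t‖ ^ 2) * Real.exp (-(4 * c) / t))
    (fun t ht => ((h.hasDerivAt_norm_sq_growing (by linarith)).sub
      (h.hasDerivAt_norm_sq_decaying (by linarith))).mul
      (hasDerivAt_exp_const_div (-(4 * c)) (by linarith)))
    (by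
      intro t ht
      have ht0 : 0 < t := by linarith
      have ht1 : 1 ≤ t := by linarith
      have h1 := (abs_le.1 (abs_inner_coupling_le (κ := κ) (t := t) (p t) (p t) (m t))).1
      have h2 := (abs_le.1 (abs_inner_coupling_le (κ := κ) (t := t) (m t) (p t) (m t))).2
      have hd : 0 ≤ c / t ^ 2 := by positivity
      have h3 : c / t ^ 2 * (‖p t‖ * (‖p t‖ + ‖m t‖)) + c / t ^ 2 * (‖m t‖ * (‖p t‖ + ‖m t‖))
          ≤ c / t ^ 2 * (2 * (‖p t‖ ^ 2 + ‖m t‖ ^ 2)) := by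
        rw [← mul_add]
        gcongr
        nlinarith [sq_nonneg (‖p t‖ - ‖m t‖)]
      have h4 : -(-(4 * c)) / t ^ 2 = 4 * (c / t ^ 2) := by ring
      have h5 : 2 * (c / t ^ 2) ≤ β := by
        have : 2 * c / β < t := (le_max_right _ _).trans_lt ht
        rw [div_lt_iff₀ hμ] at this
        rw [← mul_div_assoc, div_le_iff₀ (by positivity)]
        nlinarith [mul_nonneg hμ.le (sub_nonneg.2 ht1)]
      have h6 : 2 * (c / t ^ 2) * ‖m t‖ ^ 2 ≤ β * ‖m t‖ ^ 2 := by gcongr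
      simp only [Pi.sub_apply]
      rw [h4]
      refine le_trans (mul_nonneg (a :=
        2 * inner ℝ (p t) (κ / (t : ℂ) ^ 2 * (p t - m t)) - (-(4 * β) * ‖m t‖ ^ 2
          + 2 * inner ℝ (m t) (κ / (t : ℂ) ^ 2 * (p t - m t)))
          + 4 * (c / t ^ 2) * (‖p t‖ ^ 2 - ‖m t‖ ^ 2)) ?_ (Real.exp_pos (-(4 * c) / t)).le)
          (le_of_eq ?_)
      · linarith
      · ring)
  set δ := ‖p (S + 1)‖ ^ 2 * Real.exp (-(4 * c) / (S + 1)) with hδ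
  have hδ0 : 0 < δ := by positivity
  have hsq : Tendsto (fun t => ‖p t‖ ^ 2) atTop (𝓝 0) := by
    simpa using (hlim.norm).pow 2
  refine absurd (ge_of_tendsto hsq (b := δ) ?_) (not_le.2 hδ0)
  filter_upwards [eventually_ge_atTop (S + 1)] with t ht
  have ht0 : 0 < t := by linarith
  have h1 := hmono (a := S + 1) (b := t) (by simp) (by simp; linarith) ht
  simp only [hm, norm_zero] at h1
  have h2 : Real.exp (-(4 * c) / t) ≤ 1 := Real.exp_le_one_iff.2
    (div_nonpos_of_nonpos_of_nonneg (by linarith) ht0.le)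
  have h3 := Real.exp_pos (-(4 * c) / t)
  have h4 : (‖p t‖ ^ 2 - ‖m t‖ ^ 2) * Real.exp (-(4 * c) / t) ≤ ‖p t‖ ^ 2 := by
    nlinarith [sq_nonneg ‖p t‖, sq_nonneg ‖m t‖, mul_nonneg (sq_nonneg ‖m t‖) h3.le,
      mul_nonneg (sq_nonneg ‖p t‖) (sub_nonneg.2 h2)]
  have h5 : δ = (‖p (S + 1)‖ ^ 2 - 0 ^ 2) * Real.exp (-(4 * c) / (S + 1)) := by rw [hδ]; ring
  linarith

end IsModePair

/-! ### The scalar equation and its reduction to modes. -/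

/-- `z`, with velocity `ζ`, solves `z'' + (3 / t) z' + lam z = 0` on `[t₀, ∞)`. -/
structure IsScalarTrajectory (lam : ℂ) (t₀ : ℝ) (z ζ : ℝ → ℂ) : Prop where
  hasDeriv_pos : ∀ t, t₀ ≤ t → HasDerivWithinAt z (ζ t) (Set.Ici t₀) t
  hasDeriv_vel : ∀ t, t₀ ≤ t →
    HasDerivWithinAt ζ (-(3 / (t : ℂ) * ζ t) - lam * z t) (Set.Ici t₀) t

/-- `(y' + ν y) exp (-μ t)` for `y = t ^ (3 / 2) z`. -/
noncomputable def modeCoeff (μ ν : ℂ) (z ζ : ℝ → ℂ) (t : ℝ) : ℂ :=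
  ((t : ℂ) * (√t : ℝ) * (ζ t + ν * z t) + 3 / 2 * (√t : ℝ) * z t) * Complex.exp (-μ * t)

theorem modeCoeff_add (μ ν : ℂ) (z ζ z' ζ' : ℝ → ℂ) (t : ℝ) :
    modeCoeff μ ν (fun t => z t + z' t) (fun t => ζ t + ζ' t) t =
      modeCoeff μ ν z ζ t + modeCoeff μ ν z' ζ' t := by
  simp only [modeCoeff]
  ring

theorem modeCoeff_const_mul (μ ν c : ℂ) (z ζ : ℝ → ℂ) (t : ℝ) :
    modeCoeff μ ν (fun t => c * z t) (fun t => c * ζ t) t = c * modeCoeff μ ν z ζ t := by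
  simp only [modeCoeff]
  ring

theorem modeCoeff_sub_modeCoeff_neg (μ : ℂ) (z ζ : ℝ → ℂ) (t : ℝ) :
    modeCoeff μ μ z ζ t - modeCoeff μ (-μ) z ζ t =
      2 * μ * ((t : ℂ) * (√t : ℝ) * z t) * Complex.exp (-μ * t) := by
  simp only [modeCoeff]
  ring

namespace IsScalarTrajectory

variable {lam μ : ℂ} {t₀ : ℝ} {z ζ z' ζ' : ℝ → ℂ}

theorem add (h : IsScalarTrajectory lam t₀ z ζ) (h' : IsScalarTrajectory lam t₀ z' ζ') :
    IsScalarTrajectory lam t₀ (fun t => z t + z' t) (fun t => ζ t + ζ' t) where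
  hasDeriv_pos t ht := (h.hasDeriv_pos t ht).add (h'.hasDeriv_pos t ht)
  hasDeriv_vel t ht :=
    ((h.hasDeriv_vel t ht).add (h'.hasDeriv_vel t ht)).congr_deriv (by ring)

theorem const_mul (h : IsScalarTrajectory lam t₀ z ζ) (c : ℂ) :
    IsScalarTrajectory lam t₀ (fun t => c * z t) (fun t => c * ζ t) where
  hasDeriv_pos t ht := (h.hasDeriv_pos t ht).const_mul c
  hasDeriv_vel t ht := ((h.hasDeriv_vel t ht).const_mul c).congr_deriv (by ring)

theorem zero : IsScalarTrajectory lam t₀ (fun _ => 0) (fun _ => 0) where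
  hasDeriv_pos t _ := hasDerivWithinAt_const t _ 0
  hasDeriv_vel t _ := (hasDerivWithinAt_const t _ (0 : ℂ)).congr_deriv (by simp)

theorem hasDerivAt_modeCoeff (h : IsScalarTrajectory lam t₀ z ζ) (ht₀ : 0 < t₀) (ν : ℂ) {t : ℝ}
    (ht : t₀ < t) :
    HasDerivAt (modeCoeff μ ν z ζ)
      (((t : ℂ) * (√t : ℝ) * (ν * ζ t - lam * z t) + 3 / 2 * (√t : ℝ) * (ν * z t)
        + 3 / (4 * (√t : ℝ)) * z t) * Complex.exp (-μ * t)
        + -μ * modeCoeff μ ν z ζ t) t := by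
  have ht0 : 0 < t := ht₀.trans ht
  have hz := (h.hasDeriv_pos t ht.le).hasDerivAt (Ici_mem_nhds ht)
  have hζ := (h.hasDeriv_vel t ht.le).hasDerivAt (Ici_mem_nhds ht)
  have hid : HasDerivAt (fun s : ℝ => (s : ℂ)) 1 t := by
    simpa using (hasDerivAt_id t).ofReal_comp
  have hs : HasDerivAt (fun s : ℝ => ((√s : ℝ) : ℂ)) ((1 / (2 * √t) : ℝ) : ℂ) t :=
    (Real.hasDerivAt_sqrt ht0.ne').ofReal_comp
  have he : HasDerivAt (fun s : ℝ => Complex.exp (-μ * s)) (Complex.exp (-μ * t) * (-μ * 1)) t :=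
    (hid.const_mul (-μ)).cexp
  have hs0 : ((√t : ℝ) : ℂ) ≠ 0 := by exact_mod_cast (Real.sqrt_pos.2 ht0).ne'
  have hss : (t : ℂ) = ((√t : ℝ) : ℂ) ^ 2 := by
    exact_mod_cast (Real.sq_sqrt ht0.le).symm
  refine ((((hid.mul hs).mul (hζ.add (hz.const_mul ν))).add
    ((hs.const_mul (3 / 2)).mul hz)).mul he).congr_deriv ?_
  simp only [modeCoeff, Pi.add_apply, Pi.mul_apply]
  push_cast
  rw [hss]
  generalize ((√t : ℝ) : ℂ) = s at hs0 ⊢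
  field_simp
  ring

theorem isModePair (h : IsScalarTrajectory lam t₀ z ζ) (ht₀ : 0 < t₀) (hμ : μ ^ 2 = -lam)
    (hμ0 : μ ≠ 0) :
    IsModePair μ (3 / (8 * μ)) t₀ (modeCoeff μ μ z ζ) (modeCoeff μ (-μ) z ζ) := by
  have key : ∀ t : ℝ, t₀ < t → 3 / (8 * μ) / (t : ℂ) ^ 2 *
      (2 * μ * ((t : ℂ) * (√t : ℝ) * z t) * Complex.exp (-μ * t)) =
      3 / (4 * (√t : ℝ)) * z t * Complex.exp (-μ * t) := by
    intro t ht
    have ht0 : 0 < t := ht₀.trans ht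
    have hs0 : ((√t : ℝ) : ℂ) ≠ 0 := by exact_mod_cast (Real.sqrt_pos.2 ht0).ne'
    have hss : (t : ℂ) = ((√t : ℝ) : ℂ) ^ 2 := by
      exact_mod_cast (Real.sq_sqrt ht0.le).symm
    generalize Complex.exp (-μ * t) = e
    rw [hss]
    generalize ((√t : ℝ) : ℂ) = s at hs0 ⊢
    field_simp
    ring
  have hlam : lam = -μ ^ 2 := by rw [hμ, neg_neg]
  constructor
  · intro t ht
    refine (h.hasDerivAt_modeCoeff ht₀ μ ht).congr_deriv ?_
    rw [modeCoeff_sub_modeCoeff_neg, key t ht, hlam]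
    simp only [modeCoeff]
    ring
  · intro t ht
    refine (h.hasDerivAt_modeCoeff ht₀ (-μ) ht).congr_deriv ?_
    rw [modeCoeff_sub_modeCoeff_neg, key t ht, hlam]
    simp only [modeCoeff]
    ring

/-- Abel's identity: the damping $3/t$ has integrating factor $t^3$. -/
theorem wronskian_eq (h : IsScalarTrajectory lam t₀ z ζ) (h' : IsScalarTrajectory lam t₀ z' ζ')
    (ht₀ : 0 < t₀) {t : ℝ} (ht : t₀ ≤ t) :
    (t : ℂ) ^ 3 * (z t * ζ' t - z' t * ζ t) =
      (t₀ : ℂ) ^ 3 * (z t₀ * ζ' t₀ - z' t₀ * ζ t₀) := by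
  have hd : ∀ s, t₀ ≤ s → HasDerivWithinAt
      (fun s : ℝ => (s : ℂ) ^ 3 * (z s * ζ' s - z' s * ζ s)) 0 (Set.Ici t₀) s := by
    intro s hs
    have hs0 : (s : ℂ) ≠ 0 := by exact_mod_cast (ht₀.trans_le hs).ne'
    have hid : HasDerivWithinAt (fun s : ℝ => (s : ℂ)) 1 (Set.Ici t₀) s := by
      simpa using (hasDerivAt_id s).ofReal_comp.hasDerivWithinAt
    refine ((hid.pow 3).mul (((h.hasDeriv_pos s hs).mul (h'.hasDeriv_vel s hs)).sub
      ((h'.hasDeriv_pos s hs).mul (h.hasDeriv_vel s hs)))).congr_deriv ?_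
    simp only [Pi.sub_apply, Pi.mul_apply, Pi.pow_apply]
    field_simp
    push_cast
    ring
  refine constant_of_has_deriv_right_zero (f := fun s : ℝ => (s : ℂ) ^ 3 *
    (z s * ζ' s - z' s * ζ s)) (a := t₀) (b := t)
    (fun s hs => ((hd s hs.1).continuousWithinAt).mono Set.Icc_subset_Ici_self)
    (fun s hs => (hd s hs.1).mono (Set.Ici_subset_Ici.2 hs.1)) t ⟨ht, le_rfl⟩

/-- Not every solution of the scalar equation is subdominant. -/
theorem not_tendsto_zero_of_fundamental (h : IsScalarTrajectory lam t₀ z ζ)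
    (h' : IsScalarTrajectory lam t₀ z' ζ') (ht₀ : 0 < t₀) (hμ : μ ^ 2 = -lam) (hre : 0 < μ.re)
    (hw : z t₀ * ζ' t₀ - z' t₀ * ζ t₀ ≠ 0)
    (hz : Tendsto (modeCoeff μ μ z ζ) atTop (𝓝 0)) :
    ¬ Tendsto (modeCoeff μ μ z' ζ') atTop (𝓝 0) := by
  intro hz'
  have hμ0 : μ ≠ 0 := by
    rintro rfl
    simp at hre
  obtain ⟨T, hT, H⟩ := IsModePair.exists_forall_not_tendsto_zero (κ := 3 / (8 * μ)) hre ht₀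
  have hT0 : 0 < T := ht₀.trans hT
  -- These coefficients cancel the decaying modes at $T$; the growing mode left there is a nonzero
  -- multiple of the Wronskian.
  set A := modeCoeff μ (-μ) z' ζ' T with hA
  set B := -modeCoeff μ (-μ) z ζ T with hB
  refine H _ _ (((h.isModePair ht₀ hμ hμ0).const_mul A).add
    ((h'.isModePair ht₀ hμ hμ0).const_mul B)) ?_ ?_ ?_
  · simp only [hA, hB]
    ring
  · have hW := h.wronskian_eq h' ht₀ hT.le
    have hss : (T : ℂ) = ((√T : ℝ) : ℂ) ^ 2 := by
      exact_mod_cast (Real.sq_sqrt hT0.le).symm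
    have : A * modeCoeff μ μ z ζ T + B * modeCoeff μ μ z' ζ' T = 2 * μ *
        ((t₀ : ℂ) ^ 3 * (z t₀ * ζ' t₀ - z' t₀ * ζ t₀)) * Complex.exp (-μ * T) ^ 2 := by
      rw [← hW, hA, hB]
      simp only [modeCoeff]
      generalize Complex.exp (-μ * T) = e
      rw [hss]
      ring
    rw [this]
    have ht₀' : (t₀ : ℂ) ≠ 0 := by exact_mod_cast ht₀.ne'
    exact mul_ne_zero (mul_ne_zero (mul_ne_zero two_ne_zero hμ0)
      (mul_ne_zero (pow_ne_zero 3 ht₀') hw)) (pow_ne_zero 2 (Complex.exp_ne_zero _))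
  · simpa using (hz.const_mul A).add (hz'.const_mul B)

theorem exists_tendsto_norm_div (h : IsScalarTrajectory lam t₀ z ζ) (ht₀ : 0 < t₀)
    (hμ : μ ^ 2 = -lam) (hre : 0 < μ.re) (hz : ¬ Tendsto (modeCoeff μ μ z ζ) atTop (𝓝 0)) :
    ∃ C : ℝ, 0 < C ∧ Tendsto (fun t => ‖z t‖ / (t ^ (-(3 / 2) : ℝ) * Real.exp (μ.re * t)))
      atTop (𝓝 C) := by
  have hμ0 : μ ≠ 0 := by
    rintro rfl
    simp at hre
  have hp := h.isModePair ht₀ hμ hμ0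
  obtain ⟨L, hL⟩ := hp.exists_tendsto_growing hre ht₀
  have hL0 : L ≠ 0 := fun h0 => hz (h0 ▸ hL)
  have hn : 0 < ‖2 * μ‖ := norm_pos_iff.2 (mul_ne_zero two_ne_zero hμ0)
  refine ⟨‖L‖ / ‖2 * μ‖, div_pos (norm_pos_iff.2 hL0) hn, ?_⟩
  have hlim := ((hL.sub (hp.tendsto_decaying hre ht₀)).norm).div_const ‖2 * μ‖
  rw [sub_zero] at hlim
  refine hlim.congr' ?_
  filter_upwards [eventually_gt_atTop 0] with t ht
  have h32 : t ^ (-(3 / 2) : ℝ) = (t * √t)⁻¹ := by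
    rw [Real.rpow_neg ht.le, Real.sqrt_eq_rpow, show (3 / 2 : ℝ) = 1 + 1 / 2 by norm_num,
      Real.rpow_add ht, Real.rpow_one]
  have hexp : ‖Complex.exp (-μ * t)‖ = (Real.exp (μ.re * t))⁻¹ := by
    rw [Complex.norm_exp, ← Real.exp_neg]
    simp
  rw [modeCoeff_sub_modeCoeff_neg, norm_mul, norm_mul, hexp, norm_mul _ (z t),
    norm_mul (t : ℂ), Complex.norm_real, Complex.norm_real, Real.norm_of_nonneg ht.le,
    Real.norm_of_nonneg (Real.sqrt_nonneg t), h32]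
  have := (Real.sqrt_pos.2 ht).ne'
  have := (Real.exp_pos (μ.re * t)).ne'
  field_simp

end IsScalarTrajectory

/-! ### From sharp asymptotics to the growth rate. -/

theorem growsExponentiallyAtRate_of_tendsto {f : ℝ → ℝ} {r C : ℝ} (hr : 0 < r) (hC : 0 < C)
    (h : Tendsto (fun t => f t / (t ^ (-(3 / 2) : ℝ) * Real.exp (r * t))) atTop (𝓝 C)) :
    GrowsExponentiallyAtRate f r := by
  have hlogt : Tendsto (fun t : ℝ => Real.log t / t) atTop (𝓝 0) := by
    simpa using Real.isLittleO_log_id_atTop.tendsto_div_nhds_zero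
  have hlog := h.log hC.ne'
  have hratio : Tendsto (fun t => Real.log (f t) / t) atTop (𝓝 r) := by
    have h1 := ((hlog.div_atTop tendsto_id).add (hlogt.const_mul (-(3 / 2)))).add_const r
    rw [mul_zero, add_zero, zero_add] at h1
    refine h1.congr' ?_
    filter_upwards [eventually_gt_atTop 0, h.eventually_ne hC.ne'] with t ht hne
    have h2 : f t ≠ 0 := fun h0 => hne (by rw [h0, zero_div])
    have h3 := Real.rpow_pos_of_pos ht (-(3 / 2))
    rw [Real.log_div h2 (by positivity), Real.log_mul h3.ne' (Real.exp_ne_zero _), Real.log_exp,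
      Real.log_rpow ht]
    simp only [id]
    field_simp
    ring
  refine ⟨?_, hratio, C, hC, h⟩
  have hinf : Tendsto (fun t : ℝ => t ^ (-(3 / 2) : ℝ) * Real.exp (r * t)) atTop atTop := by
    refine (tendsto_exp_mul_div_rpow_atTop (3 / 2) r hr).congr' ?_
    filter_upwards [eventually_gt_atTop 0] with t ht
    rw [Real.rpow_neg ht.le]
    field_simp
  refine (h.pos_mul_atTop hC hinf).congr' ?_
  filter_upwards [eventually_gt_atTop 0] with t ht
  have h3 := Real.rpow_pos_of_pos ht (-(3 / 2))
  exact div_mul_cancel₀ _ (by positivity)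

/-! ### The exponent $\mu=\pm i\sqrt\lambda$. -/

theorem Complex.abs_im_sqrt (z : ℂ) : |z.sqrt.im| = √((‖z‖ - z.re) / 2) := by
  rw [Complex.sqrt_eq_real_add_ite]
  split_ifs <;> simp <;> positivity

theorem Complex.sq_sqrt (z : ℂ) : z.sqrt ^ 2 = z := by
  rw [Complex.sqrt, ← Nat.cast_ofNat (n := 2), Complex.cpow_nat_inv_pow z two_ne_zero]

theorem Complex.exists_sq_eq_neg_re_eq (z : ℂ) : ∃ μ : ℂ, μ ^ 2 = -z ∧ μ.re = |z.sqrt.im| := by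
  rcases abs_choice z.sqrt.im with h | h
  · exact ⟨-(Complex.I * z.sqrt), by rw [neg_sq, mul_pow, Complex.I_sq, Complex.sq_sqrt]; ring,
      by rw [h]; simp⟩
  · exact ⟨Complex.I * z.sqrt, by rw [mul_pow, Complex.I_sq, Complex.sq_sqrt]; ring,
      by rw [h]; simp⟩

/-! ### Modal coordinates and the exceptional subspace. -/

/-- The complex coordinate `w^* x`. -/
noncomputable def modalCoord {N : ℕ} (w : Fin N → ℂ) : (Fin N → ℝ) →ₗ[ℝ] ℂ where
  toFun x := star w ⬝ᵥ fun i => (x i : ℂ)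
  map_add' x y := by
    rw [← dotProduct_add]
    congr 1
    ext i
    simp
  map_smul' c x := by
    rw [RingHom.id_apply, ← dotProduct_smul]
    congr 1
    ext i
    simp

theorem modalCoord_single {N : ℕ} (w : Fin N → ℂ) (i : Fin N) :
    modalCoord w (Pi.single i 1) = star (w i) := by
  have : (fun j => ((Pi.single i (1 : ℝ) : Fin N → ℝ) j : ℂ)) = Pi.single i 1 := by
    ext j
    by_cases h : j = i
    · subst h; simp
    · simp [h]
  simp [modalCoord, this]

theorem norm_modalCoord {N : ℕ} (u v x : Fin N → ℝ) :
    ‖modalCoord (fun i => (u i : ℂ) + (v i : ℂ) * Complex.I) x‖ = modalRadius u v x := by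
  have h : modalCoord (fun i => (u i : ℂ) + (v i : ℂ) * Complex.I) x =
      ((u ⬝ᵥ x : ℝ) : ℂ) - ((v ⬝ᵥ x : ℝ) : ℂ) * Complex.I := by
    simp only [modalCoord, LinearMap.coe_mk, AddHom.coe_mk, dotProduct, Complex.ofReal_sum,
      Finset.sum_mul, ← Finset.sum_sub_distrib]
    refine Finset.sum_congr rfl fun i _ => ?_
    simp
    ring
  rw [h, modalRadius, Complex.norm_eq_sqrt_sq_add_sq]
  simp

theorem modalCoord_mulVec {N : ℕ} {G : Matrix (Fin N) (Fin N) ℝ} {lam : ℂ} {w : Fin N → ℂ}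
    (hw : IsLeftEigenvector G lam w) (x : Fin N → ℝ) :
    modalCoord w (G *ᵥ x) = lam * modalCoord w x := by
  have h : (fun i => ((G *ᵥ x) i : ℂ)) =
      G.map (fun x : ℝ => (x : ℂ)) *ᵥ fun i => (x i : ℂ) := by
    ext i
    simp [mulVec, dotProduct]
  simp only [modalCoord, LinearMap.coe_mk, AddHom.coe_mk]
  rw [h, dotProduct_mulVec, hw.2, smul_dotProduct, smul_eq_mul]

theorem IsNAGDTrajectory.isScalarTrajectory {N : ℕ} {G : Matrix (Fin N) (Fin N) ℝ} {lam : ℂ}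
    {w : Fin N → ℂ} (hw : IsLeftEigenvector G lam w) {t₀ : ℝ} {q p : ℝ → Fin N → ℝ}
    (h : IsNAGDTrajectory G t₀ q p) :
    IsScalarTrajectory lam t₀ (fun t => modalCoord w (q t)) (fun t => modalCoord w (p t)) := by
  have hd : ∀ {f : ℝ → Fin N → ℝ} {f' : Fin N → ℝ} {t : ℝ},
      HasDerivWithinAt f f' (Set.Ici t₀) t →
      HasDerivWithinAt (fun t => modalCoord w (f t)) (modalCoord w f') (Set.Ici t₀) t :=
    fun hf => (LinearMap.toContinuousLinearMap (modalCoord w)).hasFDerivAt.comp_hasDerivWithinAt _ hf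
  refine ⟨fun t ht => hd (h.hasDeriv_pos t ht), fun t ht => (hd (h.hasDeriv_vel t ht)).congr_deriv ?_⟩
  rw [map_sub, map_neg, map_smul, modalCoord_mulVec hw, Complex.real_smul]
  push_cast
  rfl

/-- Initial data whose modal coordinate extends to a subdominant scalar solution. -/
noncomputable def subdominantData {N : ℕ} (lam μ : ℂ) (w : Fin N → ℂ) (t₀ : ℝ) :
    Submodule ℝ ((Fin N → ℝ) × (Fin N → ℝ)) where
  carrier := {x | ∃ z ζ : ℝ → ℂ, IsScalarTrajectory lam t₀ z ζ ∧ z t₀ = modalCoord w x.1 ∧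
    ζ t₀ = modalCoord w x.2 ∧ Tendsto (modeCoeff μ μ z ζ) atTop (𝓝 0)}
  add_mem' := by
    rintro x x' ⟨z, ζ, h, h1, h2, h3⟩ ⟨z', ζ', h', h1', h2', h3'⟩
    refine ⟨_, _, h.add h', by simp [h1, h1'], by simp [h2, h2'], ?_⟩
    rw [funext (modeCoeff_add μ μ z ζ z' ζ')]
    simpa using h3.add h3'
  zero_mem' := by
    refine ⟨_, _, IsScalarTrajectory.zero, by simp, by simp, ?_⟩
    exact tendsto_const_nhds.congr fun t => by simp [modeCoeff]
  smul_mem' := by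
    rintro c x ⟨z, ζ, h, h1, h2, h3⟩
    refine ⟨_, _, h.const_mul c, by simp [h1], by simp [h2], ?_⟩
    rw [funext (modeCoeff_const_mul μ μ c z ζ)]
    simpa using h3.const_mul (c : ℂ)

/-- If every datum were subdominant, membership itself would supply solutions with data $(e_i,0)$
and $(0,e_i)$, so no existence theorem is needed. For $w_i\ne0$ their Wronskian at $t_0$ is
$\overline{w_i}^2\ne0$. -/
theorem subdominantData_ne_top {N : ℕ} {lam μ : ℂ} {w : Fin N → ℂ} (hw : w ≠ 0) {t₀ : ℝ}
    (ht₀ : 0 < t₀) (hμ : μ ^ 2 = -lam) (hre : 0 < μ.re) :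
    subdominantData lam μ w t₀ ≠ ⊤ := by
  intro htop
  obtain ⟨i, hi⟩ := Function.ne_iff.1 hw
  have h1 : (Pi.single i 1, 0) ∈ subdominantData lam μ w t₀ := htop ▸ Submodule.mem_top
  have h2 : (0, Pi.single i 1) ∈ subdominantData lam μ w t₀ := htop ▸ Submodule.mem_top
  obtain ⟨z, ζ, h, hz, hζ, hlim⟩ := h1
  obtain ⟨z', ζ', h', hz', hζ', hlim'⟩ := h2
  refine h.not_tendsto_zero_of_fundamental h' ht₀ hμ hre ?_ hlim hlim'
  rw [hz, hζ, hz', hζ']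
  simp only [modalCoord_single, map_zero, mul_zero, sub_zero]
  exact mul_self_ne_zero.2 (star_ne_zero.2 hi)

theorem mainTheorem10 {N : ℕ} (G : Matrix (Fin N) (Fin N) ℝ) (a b : ℝ) (hb : b ≠ 0)
    (u v : Fin N → ℝ)
    (hw : IsLeftEigenvector G ((a : ℂ) + (b : ℂ) * Complex.I)
      (fun i => (u i : ℂ) + (v i : ℂ) * Complex.I))
    (t₀ : ℝ) (ht₀ : 0 < t₀) :
    |(Complex.sqrt ((a : ℂ) + (b : ℂ) * Complex.I)).im|
        = Real.sqrt ((Real.sqrt (a ^ 2 + b ^ 2) - a) / 2) ∧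
    0 < Real.sqrt ((Real.sqrt (a ^ 2 + b ^ 2) - a) / 2) ∧
    ForGenericInitialConditions (fun q₀ v₀ : Fin N → ℝ =>
      ∀ q p : ℝ → Fin N → ℝ, IsNAGDTrajectory G t₀ q p → q t₀ = q₀ → p t₀ = v₀ →
        GrowsExponentiallyAtRate (fun t => modalRadius u v (q t))
          |(Complex.sqrt ((a : ℂ) + (b : ℂ) * Complex.I)).im|) := by
  have him : |(Complex.sqrt ((a : ℂ) + (b : ℂ) * Complex.I)).im|
      = Real.sqrt ((Real.sqrt (a ^ 2 + b ^ 2) - a) / 2) := by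
    rw [Complex.abs_im_sqrt, Complex.norm_add_mul_I]
    simp
  have hpos : 0 < Real.sqrt ((Real.sqrt (a ^ 2 + b ^ 2) - a) / 2) := by
    have hb2 : 0 < b ^ 2 := by positivity
    have : a < Real.sqrt (a ^ 2 + b ^ 2) := Real.lt_sqrt_of_sq_lt (by linarith)
    exact Real.sqrt_pos.2 (by linarith)
  refine ⟨him, hpos, ?_⟩
  obtain ⟨μ, hμ, hre⟩ := Complex.exists_sq_eq_neg_re_eq ((a : ℂ) + (b : ℂ) * Complex.I)
  rw [← hre] at him ⊢
  rw [← him] at hpos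
  refine ⟨subdominantData _ μ _ t₀, subdominantData_ne_top hw.1 ht₀ hμ hpos, ?_⟩
  rintro q₀ v₀ hE q p hqp rfl rfl
  have hs := hqp.isScalarTrajectory hw
  obtain ⟨C, hC, hlim⟩ := hs.exists_tendsto_norm_div ht₀ hμ hpos
    -- The trajectory's own coordinate would witness membership in $E$, so uniqueness of solutions
    -- is not needed.
    fun h0 => hE ⟨_, _, hs, rfl, rfl, h0⟩
  simp only [norm_modalCoord] at hlim
  exact growsExponentiallyAtRate_of_tendsto hpos hC hlim
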